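/- Let $1<p\le \frac{2n}{n+2}$ (so that $n\ge 3$), let $p^*=\frac{np}{n-p}$, and for $a_0>0$ let $$v(x)=v_{a_0}(x)=\frac{a_0}{\bigl(1+|x|^{\frac p{p-1}}\bigr)^{\frac{n-p}{p}}},\qquad x\in\mathbb R^n .$$ Let $\dot W^{1,p}(\mathbb R^n)$ be the closure of $C_c^\infty(\mathbb R^n)$ with respect to the norm $\bigl(\int_{\mathbb R^n}|D\psi|^p\,dx\bigr)^{1/p}$, and let $\dot W^{1,2}(\mathbb R^n;|Dv|^{p-2})$ be the closure, with respect to the norm $\bigl(\int_{\mathbb R^n}|D\psi|^2|Dv|^{p-2}\,dx\bigr)^{1/2}$, of the space of compactly supported $C^1$ functions that are constant in a neighbourhood of the origin (both closures are regarded as spaces of locally integrable functions, limits being taken also in $L^1_{\rm loc}(\mathbb R^n)$). There exist constants $\epsilon_0=\epsilon_0(n,p)>0$ and $C=C(n,p)>0$ such that the following holds for every $a_0>0$ with $\frac12\le\|v\|_{L^{p^*}(\mathbb R^n)}\le 2$. For every $\epsilon\in(0,\epsilon_0)$ and every $\varphi\in\dot W^{1,p}(\mathbb R^n)\cap\dot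 W^{1,2}(\mathbb R^n;|Dv|^{p-2})$ with $$\int_{\mathbb R^n}\bigl(|Dv|+\epsilon|D\varphi|\bigr)^{p-2}|D\varphi|^2\,dx\le 1,$$ one has $$\int_{\mathbb R^n}\bigl(v+\epsilon|\varphi|\bigr)^{p^*-2}|\varphi|^2\,dx\le C\int_{\mathbb R^n}\bigl(|Dv|+\epsilon|D\varphi|\bigr)^{p-2}|D\varphi|^2\,dx .$$ -/

import Mathlib

open MeasureTheory Filter Topology
open scoped ENNReal ContDiff

noncomputable section

namespace SobolevStability

/-- Euclidean space `ℝⁿ`. -/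
abbrev Eucl (n : ℕ) : Type := EuclideanSpace ℝ (Fin n)

/-- The Sobolev conjugate exponent `p* = n p / (n - p)`. -/
def pStar (n : ℕ) (p : ℝ) : ℝ := n * p / (n - p)

/-- The extremal `v(x) = a₀ / (1 + |x| ^ (p / (p - 1))) ^ ((n - p) / p)`. -/
def bubble (n : ℕ) (p a₀ : ℝ) (x : Eucl n) : ℝ :=
  a₀ / (1 + ‖x‖ ^ (p / (p - 1))) ^ ((n - p) / p)

/-- `G` is the weak (distributional) gradient of the locally integrable function `φ`. -/
def HasWeakGradient {n : ℕ} (φ : Eucl n → ℝ) (G : Eucl n → Eucl n) : Prop :=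
  LocallyIntegrable φ ∧ LocallyIntegrable G ∧
    ∀ η : Eucl n → ℝ, ContDiff ℝ ∞ η → HasCompactSupport η →
      ∫ x, φ x • gradient η x = -∫ x, η x • G x

/-- The space `C_c^∞(ℝⁿ)`. -/
def smoothCompact (n : ℕ) : Set (Eucl n → ℝ) :=
  {ψ | ContDiff ℝ ∞ ψ ∧ HasCompactSupport ψ}

/-- The space `C¹_{c,0}(ℝⁿ)` of compactly supported `C¹` functions that are constant in a
neighbourhood of the origin. -/
def c1CompactConstNearZero (n : ℕ) : Set (Eucl n → ℝ) :=
  {ψ | ContDiff ℝ 1 ψ ∧ HasCompactSupport ψ ∧ ∃ c : ℝ, ∀ᶠ x in 𝓝 (0 : Eucl n), ψ x = c}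

/-- The function `φ`, with weak gradient `G`, lies in the closure of the class `core` with respect
to the norm `(∫ |Dψ| ^ q w) ^ (1 / q)`. The convergence in `L¹_loc` identifies the limit as a
function; without it the norm, which sees only gradients, would determine `φ` only up to an
additive constant. -/
def MemGradientClosure {n : ℕ} (core : Set (Eucl n → ℝ)) (q : ℝ) (w : Eucl n → ℝ)
    (φ : Eucl n → ℝ) (G : Eucl n → Eucl n) : Prop :=
  HasWeakGradient φ G ∧
    ∃ ψ : ℕ → Eucl n → ℝ, (∀ k, ψ k ∈ core) ∧
      Tendsto (fun k => ∫⁻ x, ‖gradient (ψ k) x - G x‖ₑ ^ q * ENNReal.ofReal (w x))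
        atTop (𝓝 0) ∧
      ∀ K : Set (Eucl n), IsCompact K →
        Tendsto (fun k => ∫⁻ x in K, ‖ψ k x - φ x‖ₑ) atTop (𝓝 0)

/-- `φ ∈ Ẇ^{1,p}(ℝⁿ)`, with gradient `G`: closure of `C_c^∞` in the norm `‖Dψ‖_{L^p}`. -/
def MemHomSobolev {n : ℕ} (p : ℝ) (φ : Eucl n → ℝ) (G : Eucl n → Eucl n) : Prop :=
  MemGradientClosure (smoothCompact n) p (fun _ => 1) φ G

/-- `φ ∈ Ẇ^{1,q}(ℝⁿ; w)`, with gradient `G`: closure of `C¹_{c,0}` in the norm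
`(∫ |Dψ| ^ q w) ^ (1 / q)`. -/
def MemWeightedHomSobolev {n : ℕ} (q : ℝ) (w : Eucl n → ℝ)
    (φ : Eucl n → ℝ) (G : Eucl n → Eucl n) : Prop :=
  MemGradientClosure (c1CompactConstNearZero n) q w φ G

/-- The energy `∫ (|Dv| + ε |Dφ|) ^ (p - 2) |Dφ|²`, where `G` is the gradient of `φ`. -/
def orliczEnergy {n : ℕ} (p ε : ℝ) (v : Eucl n → ℝ) (G : Eucl n → Eucl n) : ℝ≥0∞ :=
  ∫⁻ x, ENNReal.ofReal ((‖gradient v x‖ + ε * ‖G x‖) ^ (p - 2) * ‖G x‖ ^ 2)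

end SobolevStability

end

open MeasureTheory Filter Topology
open scoped ENNReal ContDiff

namespace SobolevStability

/-! ### Elementary inequalities -/

/-! Put `ψ = εφ`. It suffices to bound `∫ (v + |ψ|)^(p*-2) ψ²` by `C (J + J^(p*/p))` with `J = ∫
(|Dv| + |Dψ|)^(p-2) |Dψ|²`: since `ε < 1` and the energy of `φ` is at most `1`, `J ≤ 1`, and `p*/p ≥
1` gives `J^(p*/p) ≤ J`. Dividing by `ε²` finishes.

Write `⟨x⟩ = (1 + |x|²)^(1/2)`. As `p < 2` and `|Dv| ≤ K v/⟨x⟩`, the density with `v/⟨x⟩` in place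
of `|Dv|` is bounded by the original one, and the zero of `Dv` at the origin no longer matters. A
Hardy inequality (`integral_hardyDensity_le`) then controls `∫ ⟨x⟩^(-p) (v² + ψ²)^((p-2)/2) ψ²`.

Where `|ψ| ≤ v`, the bound `v^(p*-p) ≤ B ⟨x⟩^(-p)` reduces the left side to the Hardy density. Where
`|ψ| ≥ v`, it is at most `|ψ|^(p*)` because `p* ≤ 2`, and `|ψ|` is comparable to `√(v² + ψ²) - v`.
The `p`-th power of the gradient of that function is bounded by the Hardy and energy densities, so
the Sobolev inequality applies (`exists_lintegral_add_rpow_le`). General `φ` follows by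
approximation and Fatou (`lintegral_add_rpow_le_of_memHomSobolev`). -/

theorem rpow_le_div_mul_rpow {q x y : ℝ} (hx : 0 < x) (hxy : x ≤ y) (hq : -1 ≤ q) :
    x ^ q ≤ y / x * y ^ q := by
  have hy : 0 < y := hx.trans_le hxy
  have h1 : 1 ≤ y / x := (one_le_div hx).2 hxy
  have h2 : (y / x) ^ (-q) ≤ y / x := by
    simpa using Real.rpow_le_rpow_of_exponent_le h1 (by linarith : -q ≤ 1)
  calc x ^ q = (y / x) ^ (-q) * y ^ q := by
        rw [Real.rpow_neg (by positivity), Real.div_rpow hy.le hx.le]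
        have := (Real.rpow_pos_of_pos hy q).ne'
        have := (Real.rpow_pos_of_pos hx q).ne'
        field_simp
    _ ≤ _ := by gcongr

/-- The decreasing power loses at most the factor `(w + t)/(w + s) ≤ t/s`, which the square regains.
-/
theorem add_rpow_mul_sq_mono {p w s t : ℝ} (hp1 : 1 < p) (hw : 0 ≤ w) (hs : 0 ≤ s)
    (hst : s ≤ t) : (w + s) ^ (p - 2) * s ^ 2 ≤ (w + t) ^ (p - 2) * t ^ 2 := by
  rcases hs.eq_or_lt with rfl | hspos
  · have : 0 ≤ (w + t) ^ (p - 2) * t ^ 2 := by positivity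
    simpa using this
  have h := rpow_le_div_mul_rpow (by positivity : 0 < w + s) (by linarith : w + s ≤ w + t)
    (by linarith : -1 ≤ p - 2)
  have ht : 0 ≤ t := hs.trans hst
  have hpos : 0 ≤ (w + t) ^ (p - 2) := by positivity
  have key : (w + t) / (w + s) * s ^ 2 ≤ t ^ 2 := by
    rw [div_mul_eq_mul_div, div_le_iff₀ (by positivity)]
    nlinarith [mul_nonneg hw (by nlinarith : 0 ≤ t ^ 2 - s ^ 2),
      mul_nonneg (mul_nonneg hs (hs.trans hst)) (sub_nonneg.2 hst)]
  calc (w + s) ^ (p - 2) * s ^ 2 ≤ (w + t) / (w + s) * (w + t) ^ (p - 2) * s ^ 2 := by gcongr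
    _ = (w + t) ^ (p - 2) * ((w + t) / (w + s) * s ^ 2) := by ring
    _ ≤ _ := by gcongr

/-- The map `t ↦ (w + t) ^ (p - 2) * t ^ 2` is dominated by the sum of its value at `τ` and a
power of the error `d`. -/
theorem add_rpow_mul_sq_le_add {p w t τ d : ℝ} (hp1 : 1 < p) (hp2 : p < 2) (hw : 0 ≤ w)
    (ht : 0 ≤ t) (hτ : 0 ≤ τ) (hd : 0 ≤ d) (h : t ≤ τ + d) :
    (w + t) ^ (p - 2) * t ^ 2 ≤ 4 * ((w + τ) ^ (p - 2) * τ ^ 2) + 4 * d ^ p := by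
  have hA : 0 ≤ (w + τ) ^ (p - 2) * τ ^ 2 := by positivity
  have hB : 0 ≤ d ^ p := by positivity
  -- Here `t ≤ 2 max(τ, d)`; monotonicity moves `t` to the doubled maximum, and the constant 4 is
  -- `2²`.
  rcases le_total d τ with hdτ | hdτ
  · rcases hτ.eq_or_lt with rfl | hτpos
    · have : t = 0 := by linarith
      subst this; simp; positivity
    have h1 := add_rpow_mul_sq_mono hp1 hw ht (by linarith : t ≤ 2 * τ)
    have h2 : (w + 2 * τ) ^ (p - 2) ≤ (w + τ) ^ (p - 2) :=
      Real.rpow_le_rpow_of_nonpos (by positivity) (by linarith) (by linarith)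
    have h3 : (w + 2 * τ) ^ (p - 2) * (2 * τ) ^ 2 ≤ (w + τ) ^ (p - 2) * (2 * τ) ^ 2 := by gcongr
    nlinarith
  · rcases hd.eq_or_lt with rfl | hdpos
    · have : t = 0 := by linarith
      subst this; simp; positivity
    have h1 := add_rpow_mul_sq_mono hp1 hw ht (by linarith : t ≤ 2 * d)
    have h2 : (w + 2 * d) ^ (p - 2) ≤ d ^ (p - 2) :=
      Real.rpow_le_rpow_of_nonpos (by positivity) (by linarith) (by linarith)
    have h3 : (w + 2 * d) ^ (p - 2) * (2 * d) ^ 2 ≤ d ^ (p - 2) * (2 * d) ^ 2 := by gcongr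
    have h4 : d ^ (p - 2) * d ^ 2 = d ^ p := by
      rw [← Real.rpow_natCast d 2, ← Real.rpow_add hdpos]; norm_num
    nlinarith

theorem sqrt_sq_add_sq_le_two_mul {a b : ℝ} (ha : 0 ≤ a) (hb : 0 ≤ b) (hab : a ≤ b) :
    √(a ^ 2 + b ^ 2) ≤ 2 * b := by
  rw [Real.sqrt_le_left (by positivity)]; nlinarith

theorem sqrt_rpow_mul_mono {p μ s t : ℝ} (hp1 : 1 < p) (hμ : 0 < μ) (hs : 0 ≤ s) (hst : s ≤ t) :
    √(μ ^ 2 + s ^ 2) ^ (p - 2) * s ≤ √(μ ^ 2 + t ^ 2) ^ (p - 2) * t := by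
  have hX : 0 < √(μ ^ 2 + s ^ 2) := by positivity
  have h := rpow_le_div_mul_rpow hX (Real.sqrt_le_sqrt (by gcongr : μ ^ 2 + s ^ 2 ≤ μ ^ 2 + t ^ 2))
    (by linarith : -1 ≤ p - 2)
  have hts : √(μ ^ 2 + t ^ 2) / √(μ ^ 2 + s ^ 2) * s ≤ t := by
    rw [div_mul_eq_mul_div, div_le_iff₀ hX]
    apply le_of_sq_le_sq _ (by have := hs.trans hst; positivity)
    rw [mul_pow, mul_pow, Real.sq_sqrt (by positivity), Real.sq_sqrt (by positivity)]
    have : s ^ 2 ≤ t ^ 2 := by gcongr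
    nlinarith [sq_nonneg μ]
  calc _ ≤ √(μ ^ 2 + t ^ 2) / √(μ ^ 2 + s ^ 2) * √(μ ^ 2 + t ^ 2) ^ (p - 2) * s := by gcongr
    _ = √(μ ^ 2 + t ^ 2) ^ (p - 2) * (√(μ ^ 2 + t ^ 2) / √(μ ^ 2 + s ^ 2) * s) := by ring
    _ ≤ _ := by gcongr

/-- Young's inequality for the function `t ↦ (μ² + t²) ^ ((p - 2) / 2) * t²`. -/
theorem sqrt_rpow_mul_mul_le {p μ σ t : ℝ} (hp1 : 1 < p) (hp2 : p < 2) (hμ : 0 < μ) (hσ : 0 ≤ σ)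
    (ht : 0 ≤ t) :
    √(μ ^ 2 + σ ^ 2) ^ (p - 2) * (σ * t) ≤ 1 / 4 * (√(μ ^ 2 + σ ^ 2) ^ (p - 2) * σ ^ 2)
      + 4 * (√(μ ^ 2 + t ^ 2) ^ (p - 2) * t ^ 2) := by
  have hA : 0 ≤ √(μ ^ 2 + σ ^ 2) ^ (p - 2) := by positivity
  have hB : 0 ≤ √(μ ^ 2 + t ^ 2) ^ (p - 2) := by positivity
  -- If `4t ≤ σ`, then `σt ≤ σ²/4`; otherwise monotonicity replaces `σ` by `4t`. The small
  -- coefficient `1/4` is what allows absorption in the Hardy inequality.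
  rcases le_total (4 * t) σ with h | h
  · have : √(μ ^ 2 + σ ^ 2) ^ (p - 2) * (σ * t) ≤ √(μ ^ 2 + σ ^ 2) ^ (p - 2) * (1 / 4 * σ ^ 2) :=
      mul_le_mul_of_nonneg_left (by nlinarith) hA
    have : 0 ≤ √(μ ^ 2 + t ^ 2) ^ (p - 2) * t ^ 2 := by positivity
    linarith
  · have h1 := sqrt_rpow_mul_mono hp1 hμ hσ h
    have h2 : √(μ ^ 2 + (4 * t) ^ 2) ^ (p - 2) ≤ √(μ ^ 2 + t ^ 2) ^ (p - 2) :=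
      Real.rpow_le_rpow_of_nonpos (by positivity) (Real.sqrt_le_sqrt (by nlinarith)) (by linarith)
    have h3 : √(μ ^ 2 + σ ^ 2) ^ (p - 2) * σ * t ≤ √(μ ^ 2 + t ^ 2) ^ (p - 2) * (4 * t) * t :=
      mul_le_mul_of_nonneg_right (h1.trans (by gcongr)) ht
    have : 0 ≤ √(μ ^ 2 + σ ^ 2) ^ (p - 2) * σ ^ 2 := by positivity
    nlinarith

theorem rpow_sub_two_mul_sq {p x : ℝ} (hx : 0 < x) : x ^ (p - 2) * x ^ 2 = x ^ p := by
  rw [← Real.rpow_natCast x 2, ← Real.rpow_add hx]; norm_num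

/-- Let `q = σ/√(μ² + σ²) ≤ 1`. If `t ≥ μ`, then `t^p` is already comparable to the density at `t`.
If `t ≤ μ`, then `(q t/μ)^p ≤ q t/μ ≤ q² + (t/μ)²`, and multiplying by `μ^p` gives the two
densities. -/
theorem mul_div_sqrt_rpow_le {p μ σ t : ℝ} (hp1 : 1 < p) (hμ : 0 < μ) (hσ : 0 ≤ σ)
    (ht : 0 ≤ t) :
    (σ / √(μ ^ 2 + σ ^ 2) * t) ^ p ≤ √(μ ^ 2 + σ ^ 2) ^ (p - 2) * σ ^ 2
      + 2 * (√(μ ^ 2 + t ^ 2) ^ (p - 2) * t ^ 2) := by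
  have hN : 0 < √(μ ^ 2 + σ ^ 2) := by positivity
  have hM : 0 < √(μ ^ 2 + t ^ 2) := by positivity
  have hA : 0 ≤ √(μ ^ 2 + σ ^ 2) ^ (p - 2) * σ ^ 2 := by positivity
  have hq0 : 0 ≤ σ / √(μ ^ 2 + σ ^ 2) := by positivity
  have hq1 : σ / √(μ ^ 2 + σ ^ 2) ≤ 1 := by
    rw [div_le_one hN]; exact Real.le_sqrt_of_sq_le (by nlinarith)
  rcases le_total μ t with h | h
  · have htpos : 0 < t := hμ.trans_le h
    have h1 := rpow_le_div_mul_rpow htpos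
      (Real.le_sqrt_of_sq_le (by nlinarith) : t ≤ √(μ ^ 2 + t ^ 2)) (by linarith : -1 ≤ p - 2)
    have h2 : √(μ ^ 2 + t ^ 2) / t ≤ 2 := by
      rw [div_le_iff₀ htpos]; exact sqrt_sq_add_sq_le_two_mul hμ.le ht h
    have h3 : t ^ (p - 2) ≤ 2 * √(μ ^ 2 + t ^ 2) ^ (p - 2) := h1.trans (by gcongr)
    calc (σ / √(μ ^ 2 + σ ^ 2) * t) ^ p ≤ (1 * t) ^ p := by gcongr
      _ = t ^ (p - 2) * t ^ 2 := by rw [one_mul, rpow_sub_two_mul_sq htpos]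
      _ ≤ 2 * √(μ ^ 2 + t ^ 2) ^ (p - 2) * t ^ 2 := by gcongr
      _ ≤ _ := by linarith
  · have h1 := rpow_le_div_mul_rpow hμ
      (Real.le_sqrt_of_sq_le (by nlinarith) : μ ≤ √(μ ^ 2 + t ^ 2)) (by linarith : -1 ≤ p - 2)
    have h2 : √(μ ^ 2 + t ^ 2) / μ ≤ 2 := by
      rw [div_le_iff₀ hμ, add_comm]; exact sqrt_sq_add_sq_le_two_mul ht hμ.le h
    have h3 : μ ^ (p - 2) ≤ 2 * √(μ ^ 2 + t ^ 2) ^ (p - 2) := h1.trans (by gcongr)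
    set q := σ / √(μ ^ 2 + σ ^ 2) with hq
    have ha1 : t / μ ≤ 1 := (div_le_one hμ).2 h
    have ha0 : 0 ≤ t / μ := by positivity
    have h4 : (q * (t / μ)) ^ p ≤ q * (t / μ) := by
      simpa using Real.rpow_le_rpow_of_exponent_ge' (by positivity)
        (by nlinarith : q * (t / μ) ≤ 1) zero_le_one hp1.le
    have h5 : μ ^ p * q ^ 2 ≤ √(μ ^ 2 + σ ^ 2) ^ (p - 2) * σ ^ 2 := by
      have : μ ^ p ≤ √(μ ^ 2 + σ ^ 2) ^ p := by
        gcongr; exact Real.le_sqrt_of_sq_le (by nlinarith)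
      calc μ ^ p * q ^ 2 ≤ √(μ ^ 2 + σ ^ 2) ^ p * q ^ 2 := by gcongr
        _ = _ := by rw [← rpow_sub_two_mul_sq hN, hq]; field_simp
    have h6 : μ ^ p * (t / μ) ^ 2 ≤ 2 * (√(μ ^ 2 + t ^ 2) ^ (p - 2) * t ^ 2) := by
      calc μ ^ p * (t / μ) ^ 2 = μ ^ (p - 2) * t ^ 2 := by
            rw [← rpow_sub_two_mul_sq hμ]; field_simp
        _ ≤ 2 * √(μ ^ 2 + t ^ 2) ^ (p - 2) * t ^ 2 := by gcongr
        _ = _ := by ring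
    have hμp : 0 ≤ μ ^ p := by positivity
    calc (q * t) ^ p = (μ * (q * (t / μ))) ^ p := by congr 1; field_simp
      _ = μ ^ p * (q * (t / μ)) ^ p := Real.mul_rpow hμ.le (by positivity)
      _ ≤ μ ^ p * (q ^ 2 + (t / μ) ^ 2) := by
          gcongr; exact h4.trans (by nlinarith [sq_nonneg (q - t / μ)])
      _ ≤ _ := by linarith

theorem mul_sq_div_sqrt_rpow_le {p μ σ : ℝ} (hp1 : 1 < p) (hμ : 0 < μ) (hσ : 0 ≤ σ) :
    (μ * (σ / √(μ ^ 2 + σ ^ 2)) ^ 2) ^ p ≤ √(μ ^ 2 + σ ^ 2) ^ (p - 2) * σ ^ 2 := by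
  have hN : 0 < √(μ ^ 2 + σ ^ 2) := by positivity
  set q := σ / √(μ ^ 2 + σ ^ 2) with hq
  have hq0 : 0 ≤ q := by positivity
  have hq1 : q ≤ 1 := by
    rw [hq, div_le_one hN]; exact Real.le_sqrt_of_sq_le (by nlinarith)
  have h4 : (q ^ 2) ^ p ≤ q ^ 2 := by
    simpa using Real.rpow_le_rpow_of_exponent_ge' (by positivity)
      (by nlinarith : q ^ 2 ≤ 1) zero_le_one hp1.le
  have : μ ^ p ≤ √(μ ^ 2 + σ ^ 2) ^ p := by
    gcongr; exact Real.le_sqrt_of_sq_le (by nlinarith)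
  calc (μ * q ^ 2) ^ p = μ ^ p * (q ^ 2) ^ p := Real.mul_rpow hμ.le (by positivity)
    _ ≤ √(μ ^ 2 + σ ^ 2) ^ p * q ^ 2 := by gcongr
    _ = _ := by rw [← rpow_sub_two_mul_sq hN, hq]; field_simp

/-- Used with `μ = v/⟨x⟩`, `σ = |ψ|/⟨x⟩`, `t = |Dψ|`, where the left side dominates the `p`-th power
of the gradient of `excess`. -/
theorem truncation_rpow_le {p μ σ t K : ℝ} (hp1 : 1 < p) (hμ : 0 < μ) (hσ : 0 ≤ σ)
    (ht : 0 ≤ t) (hK : 0 ≤ K) :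
    (K * (σ / √(μ ^ 2 + σ ^ 2) * t + μ * (σ / √(μ ^ 2 + σ ^ 2)) ^ 2)) ^ p ≤
      (2 * K) ^ p * (2 * (√(μ ^ 2 + σ ^ 2) ^ (p - 2) * σ ^ 2)
        + 2 * (√(μ ^ 2 + t ^ 2) ^ (p - 2) * t ^ 2)) := by
  have h1 := mul_div_sqrt_rpow_le hp1 hμ hσ ht
  have h2 := mul_sq_div_sqrt_rpow_le hp1 hμ hσ
  set a := σ / √(μ ^ 2 + σ ^ 2) * t
  set b := μ * (σ / √(μ ^ 2 + σ ^ 2)) ^ 2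
  have ha : 0 ≤ a := by positivity
  have hb : 0 ≤ b := by positivity
  have hm : (max a b) ^ p ≤ a ^ p + b ^ p := by
    have : 0 ≤ a ^ p := by positivity
    have : 0 ≤ b ^ p := by positivity
    rcases max_choice a b with h | h <;> rw [h] <;> linarith
  calc (K * (a + b)) ^ p ≤ (2 * K * max a b) ^ p := by
        refine Real.rpow_le_rpow (by positivity) ?_ (by linarith)
        nlinarith [le_max_left a b, le_max_right a b]
    _ = (2 * K) ^ p * (max a b) ^ p := Real.mul_rpow (by positivity) (by positivity)
    _ ≤ _ := by gcongr; linarith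

/-- Since `p - 2 < 0`, only the upper bound `a ≤ Kμ` is needed; `a = |Dv|` may vanish. -/
theorem sqrt_rpow_mul_sq_le {p μ t a K : ℝ} (hp2 : p < 2) (hμ : 0 < μ)
    (ht : 0 ≤ t) (hK : 1 ≤ K) (ha : 0 ≤ a) (haK : a ≤ K * μ) :
    √(μ ^ 2 + t ^ 2) ^ (p - 2) * t ^ 2 ≤ (2 * K) ^ (2 - p) * ((a + t) ^ (p - 2) * t ^ 2) := by
  rcases ht.eq_or_lt with rfl | htpos
  · simp
  have hK0 : 0 < K := by linarith
  have h1 : a + t ≤ 2 * K * √(μ ^ 2 + t ^ 2) := by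
    have h2 : μ ≤ √(μ ^ 2 + t ^ 2) := Real.le_sqrt_of_sq_le (by nlinarith)
    have h3 : t ≤ √(μ ^ 2 + t ^ 2) := Real.le_sqrt_of_sq_le (by nlinarith)
    nlinarith
  have h4 : (2 * K * √(μ ^ 2 + t ^ 2)) ^ (p - 2) ≤ (a + t) ^ (p - 2) :=
    Real.rpow_le_rpow_of_nonpos (by positivity) h1 (by linarith)
  rw [Real.mul_rpow (by positivity) (by positivity)] at h4
  have h5 : (2 * K) ^ (2 - p) * (2 * K) ^ (p - 2) = 1 := by
    rw [← Real.rpow_add (by positivity)]; norm_num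
  calc √(μ ^ 2 + t ^ 2) ^ (p - 2) * t ^ 2
      = (2 * K) ^ (2 - p) * ((2 * K) ^ (p - 2) * √(μ ^ 2 + t ^ 2) ^ (p - 2) * t ^ 2) := by
        rw [← mul_assoc, ← mul_assoc, h5, one_mul]
    _ ≤ _ := by gcongr

/-! ### A nonlinear Hardy inequality -/

/-- The integral of the divergence of `x ↦ f x • x` vanishes. -/
theorem integral_fderiv_self {n : ℕ} {f : Eucl n → ℝ} (hf : ContDiff ℝ 1 f)
    (hfs : HasCompactSupport f) : ∫ x, fderiv ℝ f x x = -(n * ∫ x, f x) := by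
  let b := EuclideanSpace.basisFun (Fin n) ℝ
  have hfd : Continuous (fderiv ℝ f) := hf.continuous_fderiv one_ne_zero
  have hcoord (i : Fin n) : Continuous fun x : Eucl n => x i := by fun_prop
  have hcs (i : Fin n) : HasCompactSupport fun x : Eucl n => fderiv ℝ f x (b i) :=
    hfs.fderiv_apply ℝ (b i)
  have hint (i : Fin n) : Integrable fun x : Eucl n => x i * fderiv ℝ f x (b i) :=
    ((hcoord i).mul (hfd.clm_apply continuous_const)).integrable_of_hasCompactSupport
      (hcs i).mul_left
  have hd (i : Fin n) (x : Eucl n) :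
      HasFDerivAt (fun x : Eucl n => x i) (EuclideanSpace.proj i : Eucl n →L[ℝ] ℝ) x :=
    (EuclideanSpace.proj i : Eucl n →L[ℝ] ℝ).hasFDerivAt
  have hone (i : Fin n) (x : Eucl n) : fderiv ℝ (fun x : Eucl n => x i) x (b i) = 1 := by
    rw [(hd i x).fderiv]; simp [b]
  have hib (i : Fin n) : ∫ x : Eucl n, x i * fderiv ℝ f x (b i) = -∫ x, f x := by
    have := integral_mul_fderiv_eq_neg_fderiv_mul_of_integrable (μ := (volume : Measure (Eucl n)))
      (f := fun x : Eucl n => x i) (g := f) (v := b i) ?_ (hint i) ?_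
      (fun x _ => (hd i x).differentiableAt) (fun x _ => hf.differentiable one_ne_zero x)
    · simpa [hone] using this
    · simp only [hone, one_mul]
      exact hf.continuous.integrable_of_hasCompactSupport hfs
    · exact ((hcoord i).mul hf.continuous).integrable_of_hasCompactSupport hfs.mul_left
  have hsum (x : Eucl n) : fderiv ℝ f x x = ∑ i, x i * fderiv ℝ f x (b i) := by
    have h := congrArg (fderiv ℝ f x) (b.sum_repr x)
    rw [map_sum] at h
    rw [← h]
    simp [b]
  simp_rw [hsum]
  rw [integral_finsetSum _ fun i _ => hint i]
  simp [hib]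

/-- The smooth substitute `(1 + |x|²) ^ (1 / 2)` for the norm. -/
noncomputable def bracket {n : ℕ} (x : Eucl n) : ℝ := √(1 + ‖x‖ ^ 2)

theorem bracket_pos {n : ℕ} (x : Eucl n) : 0 < bracket x := by
  unfold bracket; positivity

theorem norm_le_bracket {n : ℕ} (x : Eucl n) : ‖x‖ ≤ bracket x :=
  Real.le_sqrt_of_sq_le (by linarith)

theorem contDiff_bracket {n : ℕ} : ContDiff ℝ 1 (bracket : Eucl n → ℝ) := by
  unfold bracket
  refine ContDiff.sqrt (contDiff_const.add (contDiff_norm_sq ℝ)) fun x => ?_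
  positivity

/-- The density in the Hardy inequality. -/
noncomputable def hardyDensity {n : ℕ} (p : ℝ) (v ψ : Eucl n → ℝ) (x : Eucl n) : ℝ :=
  bracket x ^ (-p) * (√(v x ^ 2 + ψ x ^ 2) ^ (p - 2) * ψ x ^ 2)

/-- A smooth form of the energy density, with `v / bracket` replacing the gradient of `v`. -/
noncomputable def gradDensity {n : ℕ} (p : ℝ) (v ψ : Eucl n → ℝ) (x : Eucl n) : ℝ :=
  √((v x / bracket x) ^ 2 + ‖fderiv ℝ ψ x‖ ^ 2) ^ (p - 2) * ‖fderiv ℝ ψ x‖ ^ 2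

theorem hardyDensity_nonneg {n : ℕ} (p : ℝ) (v ψ : Eucl n → ℝ) (x : Eucl n) :
    0 ≤ hardyDensity p v ψ x := by
  have := bracket_pos x
  unfold hardyDensity; positivity

theorem gradDensity_nonneg {n : ℕ} (p : ℝ) (v ψ : Eucl n → ℝ) (x : Eucl n) :
    0 ≤ gradDensity p v ψ x := by
  unfold gradDensity; positivity

theorem sqrt_div_sq_add_div_sq {a b r : ℝ} (hr : 0 < r) :
    √((a / r) ^ 2 + (|b| / r) ^ 2) = √(a ^ 2 + b ^ 2) / r := by
  rw [div_pow, div_pow, sq_abs, ← add_div, Real.sqrt_div' _ (by positivity),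
    Real.sqrt_sq hr.le]

theorem div_rpow_sub_two {p a r : ℝ} (ha : 0 ≤ a) (hr : 0 < r) :
    (a / r) ^ (p - 2) = r ^ (-p) * a ^ (p - 2) * r ^ 2 := by
  have : r ^ (p - 2) = (r ^ (-p) * r ^ 2)⁻¹ := by
    rw [← Real.rpow_natCast r 2, ← Real.rpow_add hr, ← Real.rpow_neg hr.le]
    congr 1; push_cast; ring
  rw [Real.div_rpow ha hr.le, this, div_inv_eq_mul]; ring

/-- The Hardy density is the energy density with `|Dψ|` replaced by `|ψ|/⟨x⟩`, so the scalar
inequalities compare the two with the same `μ = v/⟨x⟩`. -/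
theorem hardyDensity_eq {n : ℕ} (p : ℝ) (v ψ : Eucl n → ℝ) (x : Eucl n) :
    hardyDensity p v ψ x =
      √((v x / bracket x) ^ 2 + (|ψ x| / bracket x) ^ 2) ^ (p - 2) * (|ψ x| / bracket x) ^ 2 := by
  have hr := bracket_pos x
  rw [sqrt_div_sq_add_div_sq hr, div_rpow_sub_two (Real.sqrt_nonneg _) hr, div_pow, sq_abs,
    hardyDensity]
  field_simp

theorem contDiff_hardyDensity {n : ℕ} {p : ℝ} {v ψ : Eucl n → ℝ} (hv : ContDiff ℝ 1 v)
    (hv0 : ∀ x, 0 < v x) (hψ : ContDiff ℝ 1 ψ) : ContDiff ℝ 1 (hardyDensity p v ψ) := by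
  have h1 (x : Eucl n) : v x ^ 2 + ψ x ^ 2 ≠ 0 := by have := hv0 x; positivity
  have h2 (x : Eucl n) : √(v x ^ 2 + ψ x ^ 2) ≠ 0 := by have := hv0 x; positivity
  exact (contDiff_bracket.rpow_const_of_ne fun x => (bracket_pos x).ne').mul
    (((((hv.pow 2).add (hψ.pow 2)).sqrt h1).rpow_const_of_ne h2).mul (hψ.pow 2))

theorem hasCompactSupport_hardyDensity {n : ℕ} {p : ℝ} {v ψ : Eucl n → ℝ}
    (hψ : HasCompactSupport ψ) : HasCompactSupport (hardyDensity p v ψ) :=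
  hψ.mono' <| (Function.support_subset_iff'.2 fun x hx => by
    simp [hardyDensity, Function.notMem_support.1 hx]).trans subset_closure

theorem continuous_gradDensity {n : ℕ} {p : ℝ} {v ψ : Eucl n → ℝ} (hv : Continuous v)
    (hv0 : ∀ x, 0 < v x) (hψ : ContDiff ℝ 1 ψ) : Continuous (gradDensity p v ψ) := by
  have hd : Continuous fun x => ‖fderiv ℝ ψ x‖ := (hψ.continuous_fderiv one_ne_zero).norm
  have hb : Continuous fun x : Eucl n => v x / bracket x :=
    hv.div contDiff_bracket.continuous fun x => (bracket_pos x).ne'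
  refine Continuous.mul ?_ (hd.pow 2)
  refine ((hb.pow 2).add (hd.pow 2)).sqrt.rpow_const fun x => Or.inl ?_
  have := div_pos (hv0 x) (bracket_pos x)
  exact (Real.sqrt_pos.2 (add_pos_of_pos_of_nonneg (pow_pos this 2) (sq_nonneg _))).ne'

theorem hasCompactSupport_gradDensity {n : ℕ} {p : ℝ} {v ψ : Eucl n → ℝ}
    (hψ : HasCompactSupport ψ) : HasCompactSupport (gradDensity p v ψ) :=
  (hψ.fderiv ℝ).mono' <| (Function.support_subset_iff'.2 fun x hx => by
    simp [gradDensity, Function.notMem_support.1 hx]).trans subset_closure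

/-- The derivative of the Hardy density along a curve. -/
theorem neg_deriv_hardy_le {p r' v' ψ' : ℝ} {r v ψ : ℝ → ℝ} {s : ℝ} (hp1 : 1 < p) (hp2 : p < 2)
    (hr : HasDerivAt r r' s) (hv : HasDerivAt v v' s) (hψ : HasDerivAt ψ ψ' s)
    (hr0 : 0 < r s) (hv0 : 0 < v s) (hrr : r' ≤ r s) (hv' : v' ≤ 0) :
    ∃ d, HasDerivAt (fun s => r s ^ (-p) * (√(v s ^ 2 + ψ s ^ 2) ^ (p - 2) * ψ s ^ 2)) d s ∧
      -d ≤ p * (r s ^ (-p) * (√(v s ^ 2 + ψ s ^ 2) ^ (p - 2) * ψ s ^ 2)) +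
        2 * (r s ^ (-p) * (√(v s ^ 2 + ψ s ^ 2) ^ (p - 2) * (|ψ s| * |ψ'|))) := by
  have hS : 0 < v s ^ 2 + ψ s ^ 2 := by positivity
  have hQ : 0 < √(v s ^ 2 + ψ s ^ 2) := by positivity
  have h1 := hr.rpow_const (p := -p) (Or.inl hr0.ne')
  have h2 := (((hv.fun_pow 2).fun_add (hψ.fun_pow 2)).sqrt hS.ne').rpow_const (p := p - 2)
    (Or.inl hQ.ne')
  refine ⟨_, h1.fun_mul (h2.fun_mul (hψ.fun_pow 2)), ?_⟩
  have hQ2 : √(v s ^ 2 + ψ s ^ 2) ^ 2 = v s ^ 2 + ψ s ^ 2 := Real.sq_sqrt hS.le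
  set Q := √(v s ^ 2 + ψ s ^ 2) with hQdef
  have e1 : r s ^ (-p - 1) = r s ^ (-p) / r s := Real.rpow_sub_one hr0.ne' _
  have e2 : Q ^ (p - 2 - 1) = Q ^ (p - 2) / Q := Real.rpow_sub_one hQ.ne' _
  rw [e1, e2]
  have ha : 0 ≤ r s ^ (-p) := by positivity
  have hq : 0 ≤ Q ^ (p - 2) := by positivity
  generalize r s ^ (-p) = a at *
  generalize Q ^ (p - 2) = q at *
  push_cast
  have hT1 : p * (r' / r s) * (a * (q * ψ s ^ 2)) ≤ p * (a * (q * ψ s ^ 2)) := by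
    have : r' / r s ≤ 1 := (div_le_one hr0).2 hrr
    have : p * (r' / r s) ≤ p := by nlinarith
    gcongr
  -- Differentiating `Q^(p-2)` gives a `v v'` term, whose sign is favourable because `v` decreases,
  -- and a `ψψ'` term. The latter joins the derivative of `ψ²` with coefficient `(2-p)z - 2`, which
  -- lies in `[-2, 0]`.
  set z := ψ s ^ 2 / Q ^ 2 with hz
  have hz0 : 0 ≤ z := by positivity
  have hz1 : z ≤ 1 := by
    rw [hz, div_le_one (by positivity), hQ2]; nlinarith [sq_nonneg (v s)]
  have hT2 : (2 - p) * (a * q) * z * (v s * v') ≤ 0 := by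
    apply mul_nonpos_of_nonneg_of_nonpos
    · have : 0 ≤ 2 - p := by linarith
      positivity
    · exact mul_nonpos_of_nonneg_of_nonpos hv0.le hv'
  have hT3 : (a * q) * (((2 - p) * z - 2) * (ψ s * ψ')) ≤ (a * q) * (2 * (|ψ s| * |ψ'|)) := by
    refine mul_le_mul_of_nonneg_left ((le_abs_self _).trans ?_) (by positivity)
    rw [abs_mul, abs_mul]
    refine mul_le_mul_of_nonneg_right ?_ (by positivity)
    rw [abs_le]; constructor <;> nlinarith
  calc _ = p * (r' / r s) * (a * (q * ψ s ^ 2)) + (2 - p) * (a * q) * z * (v s * v')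
        + (a * q) * (((2 - p) * z - 2) * (ψ s * ψ')) := by
        rw [hz]; field_simp; ring
    _ ≤ _ := by linarith

theorem neg_fderiv_hardyDensity_le {n : ℕ} {p : ℝ} {v ψ : Eucl n → ℝ} (hp1 : 1 < p) (hp2 : p < 2)
    (hv : ContDiff ℝ 1 v) (hv0 : ∀ x, 0 < v x) (hvr : ∀ x, fderiv ℝ v x x ≤ 0)
    (hψ : ContDiff ℝ 1 ψ) (x : Eucl n) :
    -(fderiv ℝ (hardyDensity p v ψ) x x) ≤
      (p + 1 / 2) * hardyDensity p v ψ x + 8 * gradDensity p v ψ x := by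
  have hline : HasDerivAt (fun s : ℝ => s • x) x 1 := by
    simpa using (hasDerivAt_id (1 : ℝ)).smul_const x
  have along {f : Eucl n → ℝ} (hf : ContDiff ℝ 1 f) :
      HasDerivAt (fun s : ℝ => f (s • x)) (fderiv ℝ f x x) 1 := by
    have h := (hf.differentiable one_ne_zero ((1 : ℝ) • x)).hasFDerivAt.comp_hasDerivAt 1 hline
    rw [one_smul] at h
    exact h
  have hR := bracket_pos x
  have hR2 : fderiv ℝ (bracket : Eucl n → ℝ) x x ≤ bracket x := by
    have h1 : HasFDerivAt (bracket : Eucl n → ℝ) _ x :=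
      ((hasStrictFDerivAt_norm_sq x).hasFDerivAt.const_add 1).sqrt (by positivity)
    have hsq : bracket x ^ 2 = 1 + ‖x‖ ^ 2 := Real.sq_sqrt (by positivity)
    rw [h1.fderiv]
    change _ ≤ bracket x
    have : (1 / (2 * bracket x)) * (2 * ‖x‖ ^ 2) ≤ bracket x := by
      rw [div_mul_eq_mul_div, div_le_iff₀ (by positivity)]; nlinarith
    simpa [bracket] using this
  obtain ⟨d, hd, hdle⟩ := neg_deriv_hardy_le hp1 hp2 (along contDiff_bracket) (along hv) (along hψ)
    (by simpa using hR) (by simpa using hv0 x) (by simpa using hR2) (hvr x)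
  have hdeq : fderiv ℝ (hardyDensity p v ψ) x x = d :=
    (along (contDiff_hardyDensity (p := p) hv hv0 hψ)).unique hd
  rw [hdeq]
  simp only [one_smul] at hdle
  refine hdle.trans ?_
  -- Young's inequality for the cross term; doubling its constants `1/4` and `4` gives `1/2` and
  -- `8`.
  have hy := sqrt_rpow_mul_mul_le hp1 hp2 (div_pos (hv0 x) hR)
    (div_nonneg (abs_nonneg (ψ x)) hR.le) (norm_nonneg (fderiv ℝ ψ x))
  rw [← hardyDensity_eq, sqrt_div_sq_add_div_sq hR,
    div_rpow_sub_two (Real.sqrt_nonneg _) hR] at hy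
  change _ ≤ _ + 4 * gradDensity p v ψ x at hy
  have hbd : |fderiv ℝ ψ x x| ≤ ‖fderiv ℝ ψ x‖ * bracket x :=
    ((fderiv ℝ ψ x).le_opNorm x).trans (by gcongr; exact norm_le_bracket x)
  have h3 : bracket x ^ (-p) * (√(v x ^ 2 + ψ x ^ 2) ^ (p - 2) * (|ψ x| * |fderiv ℝ ψ x x|)) ≤
      bracket x ^ (-p) * √(v x ^ 2 + ψ x ^ 2) ^ (p - 2) * bracket x ^ 2 *
        (|ψ x| / bracket x * ‖fderiv ℝ ψ x‖) := by
    calc _ ≤ bracket x ^ (-p) * (√(v x ^ 2 + ψ x ^ 2) ^ (p - 2) *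
          (|ψ x| * (‖fderiv ℝ ψ x‖ * bracket x))) := by gcongr
      _ = _ := by field_simp
  change p * hardyDensity p v ψ x + _ ≤ _
  linarith

/-- With `A` and `G` the two densities, `n∫A = -∫ x·DA ≤ (p + 1/2)∫A + 8∫G`. Since `n ≥ 3` and `p <
2`, `n - p - 1/2 ≥ 1/2`, and the finite integral of `A` is absorbed. -/
theorem integral_hardyDensity_le {n : ℕ} {p : ℝ} {v ψ : Eucl n → ℝ} (hn : 3 ≤ n) (hp1 : 1 < p)
    (hp2 : p < 2) (hv : ContDiff ℝ 1 v) (hv0 : ∀ x, 0 < v x) (hvr : ∀ x, fderiv ℝ v x x ≤ 0)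
    (hψ : ContDiff ℝ 1 ψ) (hψs : HasCompactSupport ψ) :
    ∫ x, hardyDensity p v ψ x ≤ 16 * ∫ x, gradDensity p v ψ x := by
  have hA := contDiff_hardyDensity (p := p) hv hv0 hψ
  have hAs := hasCompactSupport_hardyDensity (p := p) (v := v) hψs
  have hAi := hA.continuous.integrable_of_hasCompactSupport (μ := volume) hAs
  have hGi := (continuous_gradDensity (p := p) hv.continuous hv0
    hψ).integrable_of_hasCompactSupport (μ := volume) (hasCompactSupport_gradDensity hψs)
  have hdi : Integrable fun x => fderiv ℝ (hardyDensity p v ψ) x x := by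
    refine Continuous.integrable_of_hasCompactSupport
      ((hA.continuous_fderiv one_ne_zero).clm_apply continuous_id) ?_
    refine (hAs.fderiv ℝ).mono' <| (Function.support_subset_iff'.2 fun x hx => ?_).trans
      subset_closure
    simp [Function.notMem_support.1 hx]
  have h1 : -∫ x, fderiv ℝ (hardyDensity p v ψ) x x ≤
      (p + 1 / 2) * (∫ x, hardyDensity p v ψ x) + 8 * ∫ x, gradDensity p v ψ x := by
    rw [← integral_neg, ← integral_const_mul, ← integral_const_mul,
      ← integral_add (hAi.const_mul _) (hGi.const_mul _)]
    exact integral_mono hdi.neg ((hAi.const_mul _).add (hGi.const_mul _))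
      (neg_fderiv_hardyDensity_le hp1 hp2 hv hv0 hvr hψ)
  rw [integral_fderiv_self hA hAs] at h1
  have h2 : 0 ≤ ∫ x, hardyDensity p v ψ x := integral_nonneg (hardyDensity_nonneg p v ψ)
  have h3 : (3 : ℝ) ≤ n := by exact_mod_cast hn
  nlinarith

/-! ### The inequality for smooth functions -/

/-- A smooth function comparable to `|ψ|` where `|ψ|` exceeds `v`, and to `ψ² / v` elsewhere. -/
noncomputable def excess {n : ℕ} (v ψ : Eucl n → ℝ) (x : Eucl n) : ℝ := √(v x ^ 2 + ψ x ^ 2) - v x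

theorem contDiff_excess {n : ℕ} {v ψ : Eucl n → ℝ} (hv : ContDiff ℝ 1 v)
    (hv0 : ∀ x, 0 < v x) (hψ : ContDiff ℝ 1 ψ) : ContDiff ℝ 1 (excess v ψ) :=
  (((hv.pow 2).add (hψ.pow 2)).sqrt fun x => by have := hv0 x; positivity).sub hv

theorem hasCompactSupport_excess {n : ℕ} {v ψ : Eucl n → ℝ} (hv0 : ∀ x, 0 < v x)
    (hψ : HasCompactSupport ψ) : HasCompactSupport (excess v ψ) :=
  hψ.mono' <| (Function.support_subset_iff'.2 fun x hx => by
    simp [excess, Function.notMem_support.1 hx, Real.sqrt_sq (hv0 x).le]).trans subset_closure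

theorem norm_fderiv_excess_le {n : ℕ} {v ψ : Eucl n → ℝ} {K : ℝ} (hv : ContDiff ℝ 1 v)
    (hv0 : ∀ x, 0 < v x) (hK : 1 ≤ K) (hvK : ∀ x, ‖fderiv ℝ v x‖ ≤ K * (v x / bracket x))
    (hψ : ContDiff ℝ 1 ψ) (x : Eucl n) :
    ‖fderiv ℝ (excess v ψ) x‖ ≤ K * (|ψ x| / √(v x ^ 2 + ψ x ^ 2) * ‖fderiv ℝ ψ x‖
      + v x / bracket x * (|ψ x| / √(v x ^ 2 + ψ x ^ 2)) ^ 2) := by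
  have hvx := hv0 x
  have hS : 0 < v x ^ 2 + ψ x ^ 2 := by positivity
  have dv := (hv.differentiable one_ne_zero x).hasFDerivAt
  have dψ := (hψ.differentiable one_ne_zero x).hasFDerivAt
  have hd : HasFDerivAt (excess v ψ) _ x :=
    (((dv.pow 2).add (dψ.pow 2)).sqrt hS.ne').sub dv
  rw [hd.fderiv]
  have hQ : 0 < √(v x ^ 2 + ψ x ^ 2) := by positivity
  have hQ2 : √(v x ^ 2 + ψ x ^ 2) ^ 2 = v x ^ 2 + ψ x ^ 2 := Real.sq_sqrt hS.le
  set Q := √(v x ^ 2 + ψ x ^ 2) with hQdef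
  have hvQ : v x ≤ Q := Real.le_sqrt_of_sq_le (by nlinarith)
  -- The coefficient of `Dv` is quadratic in `ψ/Q`: `1 - v/Q ≤ 1 - (v/Q)² = (ψ/Q)²`. This makes the
  -- `Dv` term controllable where `ψ` is small.
  have hc : |v x / Q - 1| ≤ (|ψ x| / Q) ^ 2 := by
    have h1 : v x / Q ≤ 1 := (div_le_one hQ).2 hvQ
    have h0 : 0 ≤ v x / Q := by positivity
    have h2 : (|ψ x| / Q) ^ 2 = 1 - (v x / Q) ^ 2 := by
      rw [div_pow, div_pow, sq_abs]; field_simp; linarith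
    rw [h2, abs_of_nonpos (by linarith)]; nlinarith
  calc _ = ‖(v x / Q - 1) • fderiv ℝ v x + (ψ x / Q) • fderiv ℝ ψ x‖ := by
        congr 1; ext y
        simp
        field_simp
        ring
    _ ≤ |v x / Q - 1| * ‖fderiv ℝ v x‖ + |ψ x / Q| * ‖fderiv ℝ ψ x‖ := by
        refine (norm_add_le _ _).trans_eq ?_
        rw [norm_smul, norm_smul, Real.norm_eq_abs, Real.norm_eq_abs]
    _ ≤ (|ψ x| / Q) ^ 2 * (K * (v x / bracket x)) + |ψ x| / Q * ‖fderiv ℝ ψ x‖ := by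
        rw [abs_div (ψ x), abs_of_pos hQ]
        gcongr
        exact hvK x
    _ ≤ _ := by
        have : 0 ≤ |ψ x| / Q * ‖fderiv ℝ ψ x‖ := by positivity
        nlinarith

theorem norm_fderiv_excess_rpow_le {n : ℕ} {p : ℝ} {v ψ : Eucl n → ℝ} {K : ℝ} (hp1 : 1 < p)
    (hv : ContDiff ℝ 1 v) (hv0 : ∀ x, 0 < v x) (hK : 1 ≤ K)
    (hvK : ∀ x, ‖fderiv ℝ v x‖ ≤ K * (v x / bracket x)) (hψ : ContDiff ℝ 1 ψ) (x : Eucl n) :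
    ‖fderiv ℝ (excess v ψ) x‖ ^ p ≤
      (2 * K) ^ p * (2 * hardyDensity p v ψ x + 2 * gradDensity p v ψ x) := by
  have hR := bracket_pos x
  have h := truncation_rpow_le (p := p) (K := K) hp1 (div_pos (hv0 x) hR)
    (div_nonneg (abs_nonneg (ψ x)) hR.le) (norm_nonneg (fderiv ℝ ψ x)) (by linarith)
  rw [← hardyDensity_eq, sqrt_div_sq_add_div_sq hR, div_div_div_cancel_right₀ hR.ne'] at h
  exact (Real.rpow_le_rpow (norm_nonneg _) (norm_fderiv_excess_le hv hv0 hK hvK hψ x)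
    (by linarith)).trans h

theorem abs_le_three_mul_excess {n : ℕ} {v ψ : Eucl n → ℝ} {x : Eucl n} (hv0 : 0 < v x)
    (h : v x ≤ |ψ x|) : |ψ x| ≤ 3 * excess v ψ x := by
  have : v x + |ψ x| / 3 ≤ √(v x ^ 2 + ψ x ^ 2) := by
    apply Real.le_sqrt_of_sq_le
    rw [← sq_abs (ψ x)]; nlinarith
  unfold excess; linarith

theorem excess_nonneg {n : ℕ} {v ψ : Eucl n → ℝ} (x : Eucl n) : 0 ≤ excess v ψ x :=
  sub_nonneg.2 (Real.le_sqrt_of_sq_le (by nlinarith [sq_nonneg (ψ x)]))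

/-- Split at `|ψ| = v`: below, factor `v^(r-2) = v^(r-p) v^(p-2)`; above, drop `v` from the base and
compare `|ψ|` with `excess`. -/
theorem add_abs_rpow_mul_sq_le {n : ℕ} {p r B : ℝ} {v ψ : Eucl n → ℝ} {x : Eucl n} (hp1 : 1 < p)
    (hr0 : 0 ≤ r)
    (hr : r ≤ 2) (hv0 : 0 < v x) (hB : v x ^ (r - p) ≤ B * bracket x ^ (-p)) :
    (v x + |ψ x|) ^ (r - 2) * |ψ x| ^ 2 ≤
      2 * B * hardyDensity p v ψ x + (3 * excess v ψ x) ^ r := by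
  have hR := bracket_pos x
  have hE : 0 ≤ (3 * excess v ψ x) ^ r := by
    have := excess_nonneg (v := v) (ψ := ψ) x; positivity
  have hB0 : 0 ≤ B * bracket x ^ (-p) := le_trans (by positivity) hB
  have hA : 0 ≤ 2 * B * hardyDensity p v ψ x := by
    unfold hardyDensity
    calc 0 ≤ 2 * (B * bracket x ^ (-p)) * (√(v x ^ 2 + ψ x ^ 2) ^ (p - 2) * ψ x ^ 2) := by
          positivity
      _ = _ := by ring
  rcases le_total (v x) |ψ x| with h | h
  · have hpos : 0 < |ψ x| := hv0.trans_le h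
    calc (v x + |ψ x|) ^ (r - 2) * |ψ x| ^ 2 ≤ |ψ x| ^ (r - 2) * |ψ x| ^ 2 := by
            have := Real.rpow_le_rpow_of_nonpos hpos (by linarith : |ψ x| ≤ v x + |ψ x|)
              (by linarith : r - 2 ≤ 0)
            gcongr
        _ = |ψ x| ^ r := rpow_sub_two_mul_sq hpos
        _ ≤ (3 * excess v ψ x) ^ r :=
            Real.rpow_le_rpow hpos.le (abs_le_three_mul_excess hv0 h) hr0
        _ ≤ _ := by linarith
  · have h1 : (v x + |ψ x|) ^ (r - 2) ≤ v x ^ (r - 2) :=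
      Real.rpow_le_rpow_of_nonpos hv0 (by linarith [abs_nonneg (ψ x)]) (by linarith)
    have h2 : v x ^ (p - 2) ≤ 2 * √(v x ^ 2 + ψ x ^ 2) ^ (p - 2) := by
      have hle := sqrt_sq_add_sq_le_two_mul (abs_nonneg (ψ x)) hv0.le h
      rw [add_comm, sq_abs] at hle
      refine (rpow_le_div_mul_rpow hv0 (Real.le_sqrt_of_sq_le (by nlinarith [sq_nonneg (ψ x)]) :
        v x ≤ √(v x ^ 2 + ψ x ^ 2)) (by linarith : -1 ≤ p - 2)).trans ?_
      gcongr
      rwa [div_le_iff₀ hv0]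
    calc (v x + |ψ x|) ^ (r - 2) * |ψ x| ^ 2 ≤ v x ^ (r - 2) * |ψ x| ^ 2 := by gcongr
      _ = v x ^ (r - p) * v x ^ (p - 2) * ψ x ^ 2 := by
          rw [← Real.rpow_add hv0, sq_abs]; ring_nf
      _ ≤ B * bracket x ^ (-p) * (2 * √(v x ^ 2 + ψ x ^ 2) ^ (p - 2)) * ψ x ^ 2 := by gcongr
      _ = 2 * B * hardyDensity p v ψ x := by unfold hardyDensity; ring
      _ ≤ _ := by linarith

theorem lintegral_hardyDensity_le {n : ℕ} {p : ℝ} {v ψ : Eucl n → ℝ} (hn : 3 ≤ n) (hp1 : 1 < p)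
    (hp2 : p < 2) (hv : ContDiff ℝ 1 v) (hv0 : ∀ x, 0 < v x) (hvr : ∀ x, fderiv ℝ v x x ≤ 0)
    (hψ : ContDiff ℝ 1 ψ) (hψs : HasCompactSupport ψ) :
    ∫⁻ x, ENNReal.ofReal (hardyDensity p v ψ x) ≤
      16 * ∫⁻ x, ENNReal.ofReal (gradDensity p v ψ x) := by
  have hAi := (contDiff_hardyDensity (p := p) hv hv0
    hψ).continuous.integrable_of_hasCompactSupport (μ := volume)
    (hasCompactSupport_hardyDensity (p := p) (v := v) hψs)
  have hGi := (continuous_gradDensity (p := p) hv.continuous hv0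
    hψ).integrable_of_hasCompactSupport (μ := volume) (hasCompactSupport_gradDensity hψs)
  rw [← ofReal_integral_eq_lintegral_ofReal hAi (ae_of_all _ (hardyDensity_nonneg p v ψ)),
    ← ofReal_integral_eq_lintegral_ofReal hGi (ae_of_all _ (gradDensity_nonneg p v ψ)),
    show (16 : ENNReal) = ENNReal.ofReal 16 by simp, ← ENNReal.ofReal_mul (by norm_num)]
  exact ENNReal.ofReal_le_ofReal (integral_hardyDensity_le hn hp1 hp2 hv hv0 hvr hψ hψs)

theorem lintegral_norm_fderiv_excess_le {n : ℕ} {p K : ℝ} {v ψ : Eucl n → ℝ} (hn : 3 ≤ n)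
    (hp1 : 1 < p) (hp2 : p < 2) (hv : ContDiff ℝ 1 v) (hv0 : ∀ x, 0 < v x)
    (hvr : ∀ x, fderiv ℝ v x x ≤ 0) (hK : 1 ≤ K)
    (hvK : ∀ x, ‖fderiv ℝ v x‖ ≤ K * (v x / bracket x))
    (hψ : ContDiff ℝ 1 ψ) (hψs : HasCompactSupport ψ) :
    ∫⁻ x, ‖fderiv ℝ (excess v ψ) x‖ₑ ^ p ≤
      ENNReal.ofReal ((2 * K) ^ p) * 34 * ∫⁻ x, ENNReal.ofReal (gradDensity p v ψ x) := by
  have hmA : Measurable fun x => ENNReal.ofReal (hardyDensity p v ψ x) :=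
    (contDiff_hardyDensity (p := p) hv hv0 hψ).continuous.measurable.ennreal_ofReal
  calc ∫⁻ x, ‖fderiv ℝ (excess v ψ) x‖ₑ ^ p
      ≤ ∫⁻ x, ENNReal.ofReal ((2 * K) ^ p) * (2 * ENNReal.ofReal (hardyDensity p v ψ x)
          + 2 * ENNReal.ofReal (gradDensity p v ψ x)) := by
        refine lintegral_mono fun x => ?_
        rw [← ofReal_norm, ENNReal.ofReal_rpow_of_nonneg (norm_nonneg _) (by linarith)]
        refine (ENNReal.ofReal_le_ofReal
          (norm_fderiv_excess_rpow_le hp1 hv hv0 hK hvK hψ x)).trans_eq ?_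
        have := hardyDensity_nonneg p v ψ x
        have := gradDensity_nonneg p v ψ x
        rw [ENNReal.ofReal_mul (by positivity), ENNReal.ofReal_add (by positivity) (by positivity),
          ENNReal.ofReal_mul (by norm_num), ENNReal.ofReal_mul (by norm_num),
          ENNReal.ofReal_ofNat]
    _ = ENNReal.ofReal ((2 * K) ^ p) * (2 * (∫⁻ x, ENNReal.ofReal (hardyDensity p v ψ x))
          + 2 * ∫⁻ x, ENNReal.ofReal (gradDensity p v ψ x)) := by
        rw [lintegral_const_mul' _ _ ENNReal.ofReal_ne_top, lintegral_add_left (hmA.const_mul _),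
          lintegral_const_mul' _ _ ENNReal.ofNat_ne_top,
          lintegral_const_mul' _ _ ENNReal.ofNat_ne_top]
    _ ≤ ENNReal.ofReal ((2 * K) ^ p) *
          (2 * (16 * ∫⁻ x, ENNReal.ofReal (gradDensity p v ψ x))
          + 2 * ∫⁻ x, ENNReal.ofReal (gradDensity p v ψ x)) := by
        gcongr
        exact lintegral_hardyDensity_le hn hp1 hp2 hv hv0 hvr hψ hψs
    _ = _ := by ring

theorem inv_pStar {n : ℕ} {p : ℝ} (hp : 0 < p) (hpn : p < n) :
    (pStar n p)⁻¹ = p⁻¹ - (n : ℝ)⁻¹ := by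
  have : (0 : ℝ) < n := hp.trans hpn
  unfold pStar
  field_simp

theorem pStar_pos {n : ℕ} {p : ℝ} (hp : 0 < p) (hpn : p < n) : 0 < pStar n p := by
  have : (0 : ℝ) < n := hp.trans hpn
  have : 0 < n - p := by linarith
  unfold pStar; positivity

/-- The Sobolev inequality, with integrals in place of norms. -/
theorem exists_lintegral_enorm_rpow_pStar_le {n : ℕ} {p : ℝ} (hp : 1 < p) (hpn : p < n) :
    ∃ S : ENNReal, S ≠ ⊤ ∧ ∀ u : Eucl n → ℝ, ContDiff ℝ 1 u → HasCompactSupport u →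
      ∫⁻ x, ‖u x‖ₑ ^ pStar n p ≤ S * (∫⁻ x, ‖fderiv ℝ u x‖ₑ ^ p) ^ (pStar n p / p) := by
  have hp0 : 0 < p := by linarith
  have hs := pStar_pos hp0 hpn
  lift p to NNReal using hp0.le
  obtain ⟨r, hr⟩ : ∃ r : NNReal, (r : ℝ) = pStar n p := ⟨⟨_, hs.le⟩, rfl⟩
  rw [← hr] at hs ⊢
  have hr0 : r ≠ 0 := by rintro rfl; simp at hs
  have hp0' : p ≠ 0 := by rintro rfl; simp at hp0
  refine ⟨(SNormLESNormFDerivOfEqConst ℝ (volume : Measure (Eucl n)) p : ENNReal) ^ (r : ℝ),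
    ENNReal.rpow_ne_top_of_nonneg hs.le ENNReal.coe_ne_top, fun u hu hus => ?_⟩
  have hfin : Module.finrank ℝ (Eucl n) = n := by simp
  have h := eLpNorm_le_eLpNorm_fderiv_of_eq (volume : Measure (Eucl n)) hu hus (p := p) (p' := r)
    (by exact_mod_cast hp.le) (by rw [hfin]; exact_mod_cast hp0.trans hpn)
    (by rw [hfin, hr]; exact inv_pStar hp0 hpn)
  rw [← eLpNorm_nnreal_pow_eq_lintegral hr0, ← eLpNorm_nnreal_pow_eq_lintegral hp0',
    ← ENNReal.rpow_mul, mul_div_cancel₀ _ hp0.ne', ← ENNReal.mul_rpow_of_nonneg _ _ hs.le]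
  exact ENNReal.rpow_le_rpow h hs.le

/-- The Poincaré inequality for compactly supported functions of class `C¹`. -/
theorem exists_lintegral_add_rpow_le {n : ℕ} {p : ℝ} (hn : 3 ≤ n) (hp1 : 1 < p) (hp2 : p < 2)
    (hr2 : pStar n p ≤ 2) {K : ℝ} (hK : 1 ≤ K) (B : ℝ) :
    ∃ C : ENNReal, C ≠ ⊤ ∧ ∀ v ψ : Eucl n → ℝ, ContDiff ℝ 1 v → (∀ x, 0 < v x) →
      (∀ x, fderiv ℝ v x x ≤ 0) → (∀ x, ‖fderiv ℝ v x‖ ≤ K * (v x / bracket x)) →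
      (∀ x, v x ^ (pStar n p - p) ≤ B * bracket x ^ (-p)) →
      ContDiff ℝ 1 ψ → HasCompactSupport ψ → ∀ J : ENNReal,
      ∫⁻ x, ENNReal.ofReal ((‖fderiv ℝ v x‖ + ‖fderiv ℝ ψ x‖) ^ (p - 2) * ‖fderiv ℝ ψ x‖ ^ 2) ≤ J →
      ∫⁻ x, ENNReal.ofReal ((v x + |ψ x|) ^ (pStar n p - 2) * |ψ x| ^ 2) ≤
        C * (J + J ^ (pStar n p / p)) := by
  have hn3 : (3 : ℝ) ≤ n := by exact_mod_cast hn
  have hr := pStar_pos (by linarith : 0 < p) (by linarith : p < n)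
  obtain ⟨S, hS, hSob⟩ := exists_lintegral_enorm_rpow_pStar_le hp1 (by linarith : p < n)
  set r := pStar n p
  have hrp : 0 ≤ r / p := by positivity
  -- `M` is the cost of replacing `|Dv|` by `v/⟨x⟩`; `C₁` comes from the Hardy term and `C₂` from
  -- the Sobolev term.
  let M := ENNReal.ofReal ((2 * K) ^ (2 - p))
  let C₁ := ENNReal.ofReal (2 * B) * 16 * M
  let C₂ := ENNReal.ofReal (3 ^ r) * (S * (ENNReal.ofReal ((2 * K) ^ p) * 34 * M) ^ (r / p))
  have hC₁ : C₁ ≠ ⊤ := by simp only [C₁, M]; finiteness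
  have hC₂ : C₂ ≠ ⊤ :=
    ENNReal.mul_ne_top ENNReal.ofReal_ne_top (ENNReal.mul_ne_top hS
      (ENNReal.rpow_ne_top_of_nonneg hrp (by simp only [M]; finiteness)))
  refine ⟨C₁ + C₂, ENNReal.add_ne_top.2 ⟨hC₁, hC₂⟩, fun v ψ hv hv0 hvr hvK hvB hψ hψs J hJ => ?_⟩
  have hG : ∫⁻ x, ENNReal.ofReal (gradDensity p v ψ x) ≤ M * J := by
    calc _ ≤ ∫⁻ x, M * ENNReal.ofReal
          ((‖fderiv ℝ v x‖ + ‖fderiv ℝ ψ x‖) ^ (p - 2) * ‖fderiv ℝ ψ x‖ ^ 2) := by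
          refine lintegral_mono fun x => ?_
          rw [← ENNReal.ofReal_mul (by positivity)]
          exact ENNReal.ofReal_le_ofReal (sqrt_rpow_mul_sq_le hp2
            (div_pos (hv0 x) (bracket_pos x)) (norm_nonneg _) hK (norm_nonneg _) (hvK x))
      _ ≤ M * J := by
          rw [lintegral_const_mul' _ _ ENNReal.ofReal_ne_top]
          gcongr
  have hmA : Measurable fun x => ENNReal.ofReal (hardyDensity p v ψ x) :=
    (contDiff_hardyDensity (p := p) hv hv0 hψ).continuous.measurable.ennreal_ofReal
  have hE := (hSob _ (contDiff_excess hv hv0 hψ) (hasCompactSupport_excess hv0 hψs)).trans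
    (mul_le_mul_right (ENNReal.rpow_le_rpow
      (lintegral_norm_fderiv_excess_le hn hp1 hp2 hv hv0 hvr hK hvK hψ hψs) hrp) S)
  have hB0 : 0 ≤ B := by
    have h := (Real.rpow_pos_of_pos (hv0 0) (r - p)).le.trans (hvB 0)
    exact nonneg_of_mul_nonneg_left h (Real.rpow_pos_of_pos (bracket_pos 0) _)
  calc ∫⁻ x, ENNReal.ofReal ((v x + |ψ x|) ^ (r - 2) * |ψ x| ^ 2)
      ≤ ∫⁻ x, (ENNReal.ofReal (2 * B) * ENNReal.ofReal (hardyDensity p v ψ x) +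
          ENNReal.ofReal (3 ^ r) * ‖excess v ψ x‖ₑ ^ r) := by
        refine lintegral_mono fun x => (ENNReal.ofReal_le_ofReal
          (add_abs_rpow_mul_sq_le hp1 hr.le hr2 (hv0 x) (hvB x))).trans_eq ?_
        have h1 := hardyDensity_nonneg p v ψ x
        have h2 := excess_nonneg (v := v) (ψ := ψ) x
        rw [ENNReal.ofReal_add (by positivity) (by positivity),
          ENNReal.ofReal_mul (by positivity : 0 ≤ 2 * B),
          Real.mul_rpow (by norm_num) h2, ENNReal.ofReal_mul (by positivity : (0 : ℝ) ≤ 3 ^ r),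
          ← ofReal_norm, Real.norm_of_nonneg h2,
          ENNReal.ofReal_rpow_of_nonneg h2 hr.le]
    _ = ENNReal.ofReal (2 * B) * (∫⁻ x, ENNReal.ofReal (hardyDensity p v ψ x)) +
          ENNReal.ofReal (3 ^ r) * ∫⁻ x, ‖excess v ψ x‖ₑ ^ r := by
        rw [lintegral_add_left (hmA.const_mul _), lintegral_const_mul' _ _ ENNReal.ofReal_ne_top,
          lintegral_const_mul' _ _ ENNReal.ofReal_ne_top]
    _ ≤ ENNReal.ofReal (2 * B) * (16 * (M * J)) + ENNReal.ofReal (3 ^ r) *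
          (S * (ENNReal.ofReal ((2 * K) ^ p) * 34 * (M * J)) ^ (r / p)) := by
        gcongr
        · exact (lintegral_hardyDensity_le hn hp1 hp2 hv hv0 hvr hψ hψs).trans (by gcongr)
        · exact hE.trans (by gcongr)
    _ = C₁ * J + C₂ * J ^ (r / p) := by
        rw [← mul_assoc _ M J, ← mul_assoc _ M J, ENNReal.mul_rpow_of_nonneg _ J hrp]
        simp only [C₁, C₂]; ring
    _ ≤ (C₁ + C₂) * (J + J ^ (r / p)) := by
        rw [mul_add]
        gcongr <;> simp

/-! ### Properties of the extremal -/

theorem bubble_eq {n : ℕ} {p a₀ : ℝ} (x : Eucl n) :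
    bubble n p a₀ x = a₀ * (1 + ‖x‖ ^ (p / (p - 1))) ^ (-((n - p) / p)) := by
  rw [bubble, Real.rpow_neg (by positivity), div_eq_mul_inv]

theorem one_lt_div_sub_one {p : ℝ} (hp1 : 1 < p) : 1 < p / (p - 1) := by
  rw [one_lt_div (by linarith)]; linarith

theorem bubble_pos {n : ℕ} {p a₀ : ℝ} (ha : 0 < a₀) (x : Eucl n) : 0 < bubble n p a₀ x := by
  unfold bubble; positivity

theorem contDiff_bubble {n : ℕ} {p a₀ : ℝ} (hp1 : 1 < p) : ContDiff ℝ 1 (bubble n p a₀) := by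
  have h : bubble n p a₀ = fun x => a₀ * (1 + ‖x‖ ^ (p / (p - 1))) ^ (-((n - p) / p)) :=
    funext bubble_eq
  rw [h]
  exact contDiff_const.mul ((contDiff_const.add
    (contDiff_norm_rpow (one_lt_div_sub_one hp1))).rpow_const_of_ne fun x => by positivity)

theorem fderiv_bubble {n : ℕ} {p a₀ : ℝ} (hp1 : 1 < p) (x : Eucl n) :
    fderiv ℝ (bubble n p a₀) x =
      -((n - p) / p * (p / (p - 1)) * (bubble n p a₀ x / (1 + ‖x‖ ^ (p / (p - 1))) *
        ‖x‖ ^ (p / (p - 1) - 2))) • innerSL ℝ x := by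
  have h : bubble n p a₀ = fun x => a₀ * (1 + ‖x‖ ^ (p / (p - 1))) ^ (-((n - p) / p)) :=
    funext bubble_eq
  have hW : 0 < 1 + ‖x‖ ^ (p / (p - 1)) := by positivity
  have hd := (((hasFDerivAt_norm_rpow x (one_lt_div_sub_one hp1)).const_add 1).rpow_const
    (p := -((n - p) / p)) (Or.inl hW.ne')).const_mul a₀
  rw [bubble_eq, h, hd.fderiv, Real.rpow_sub_one hW.ne', smul_smul, smul_smul]
  congr 1
  ring

theorem fderiv_bubble_self_nonpos {n : ℕ} {p a₀ : ℝ} (hp1 : 1 < p) (hpn : p ≤ n) (ha : 0 < a₀)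
    (x : Eucl n) : fderiv ℝ (bubble n p a₀) x x ≤ 0 := by
  have h1 : 0 ≤ p - 1 := by linarith
  have h2 : 0 ≤ n - p := by linarith
  have h3 : 0 ≤ p := by linarith
  have := (bubble_pos (n := n) (p := p) ha x).le
  rw [fderiv_bubble hp1, smul_apply, innerSL_apply_apply,
    real_inner_self_eq_norm_sq, smul_eq_mul, neg_mul, neg_nonpos]
  positivity

theorem bracket_le_one_add_norm {n : ℕ} (x : Eucl n) : bracket x ≤ 1 + ‖x‖ := by
  unfold bracket
  rw [Real.sqrt_le_left (by positivity)]
  nlinarith [norm_nonneg x]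

theorem bracket_le {n : ℕ} {γ : ℝ} (hγ : 1 ≤ γ) (x : Eucl n) :
    bracket x ≤ 2 * (1 + ‖x‖ ^ γ) := by
  have h1 := bracket_le_one_add_norm x
  rcases le_total ‖x‖ 1 with h | h
  · have : 0 ≤ ‖x‖ ^ γ := by positivity
    linarith
  · have := Real.rpow_le_rpow_of_exponent_le h hγ
    rw [Real.rpow_one] at this
    linarith

theorem rpow_sub_two_mul_self_mul_bracket_le {n : ℕ} {γ : ℝ} (hγ : 1 ≤ γ) (x : Eucl n) :
    ‖x‖ ^ (γ - 2) * ‖x‖ * bracket x ≤ 2 * (1 + ‖x‖ ^ γ) := by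
  rcases (norm_nonneg x).eq_or_lt with h | h
  · rw [← h]; simp; positivity
  have h1 := bracket_le_one_add_norm x
  have h2 : ‖x‖ ^ (γ - 2) * ‖x‖ = ‖x‖ ^ (γ - 1) := by
    rw [← Real.rpow_add_one h.ne']; ring_nf
  have h3 : ‖x‖ ^ (γ - 1) * ‖x‖ = ‖x‖ ^ γ := by
    rw [← Real.rpow_add_one h.ne']; ring_nf
  have h4 : ‖x‖ ^ (γ - 1) ≤ 1 + ‖x‖ ^ γ := by
    rcases le_total ‖x‖ 1 with h' | h'
    · have : 0 ≤ ‖x‖ ^ γ := by positivity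
      linarith [Real.rpow_le_one h.le h' (by linarith : 0 ≤ γ - 1)]
    · linarith [Real.rpow_le_rpow_of_exponent_le h' (by linarith : γ - 1 ≤ γ)]
  have h5 : 0 ≤ ‖x‖ ^ (γ - 1) := by positivity
  rw [h2]
  calc _ ≤ ‖x‖ ^ (γ - 1) * (1 + ‖x‖) := by gcongr
    _ ≤ _ := by rw [mul_add, h3]; linarith

theorem norm_fderiv_bubble_le {n : ℕ} {p a₀ : ℝ} (hp1 : 1 < p) (hpn : p ≤ n) (ha : 0 < a₀)
    (x : Eucl n) : ‖fderiv ℝ (bubble n p a₀) x‖ ≤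
      2 * ((n - p) / p * (p / (p - 1))) * (bubble n p a₀ x / bracket x) := by
  have h1 : 0 ≤ p - 1 := by linarith
  have h2 : 0 ≤ n - p := by linarith
  have h3 : 0 ≤ p := by linarith
  have hv := (bubble_pos (n := n) (p := p) ha x).le
  have hR := bracket_pos x
  have hW : 0 < 1 + ‖x‖ ^ (p / (p - 1)) := by positivity
  have key : ‖x‖ ^ (p / (p - 1) - 2) * ‖x‖ / (1 + ‖x‖ ^ (p / (p - 1))) ≤ 2 / bracket x := by
    rw [div_le_div_iff₀ hW hR]
    exact rpow_sub_two_mul_self_mul_bracket_le (one_lt_div_sub_one hp1).le x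
  rw [fderiv_bubble hp1, norm_smul, norm_neg, innerSL_apply_norm,
    Real.norm_of_nonneg (by positivity)]
  calc _ = (n - p) / p * (p / (p - 1)) * bubble n p a₀ x *
        (‖x‖ ^ (p / (p - 1) - 2) * ‖x‖ / (1 + ‖x‖ ^ (p / (p - 1)))) := by ring
    _ ≤ (n - p) / p * (p / (p - 1)) * bubble n p a₀ x * (2 / bracket x) := by gcongr
    _ = _ := by ring

/-- The exponents match: `(n-p)/p · (p* - p) = p`, so `v^(p*-p)` is a constant times `(1 +
|x|^(p/(p-1)))^(-p)`. -/
theorem bubble_rpow_le {n : ℕ} {p a₀ a : ℝ} (hp1 : 1 < p) (hpn : p < n) (ha₀ : 0 < a₀)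
    (ha : a₀ ≤ a) (x : Eucl n) :
    bubble n p a₀ x ^ (pStar n p - p) ≤ a ^ (pStar n p - p) * 2 ^ p * bracket x ^ (-p) := by
  have hn : 0 < n - p := by linarith
  have hp0 : 0 < p := by linarith
  have ha' : 0 < a := ha₀.trans_le ha
  have e : (n - p) / p * (pStar n p - p) = p := by
    unfold pStar; field_simp; ring
  have e0 : 0 ≤ pStar n p - p := by
    by_contra h
    have := mul_neg_of_pos_of_neg (div_pos hn hp0) (not_le.1 h)
    linarith
  have hR := bracket_pos x
  have hW : 0 < 1 + ‖x‖ ^ (p / (p - 1)) := by positivity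
  have h1 : (1 + ‖x‖ ^ (p / (p - 1))) ^ (-p) ≤ 2 ^ p * bracket x ^ (-p) := by
    have h := Real.rpow_le_rpow_of_nonpos hR (bracket_le (one_lt_div_sub_one hp1).le x)
      (by linarith : -p ≤ 0)
    rw [Real.mul_rpow (by norm_num) hW.le] at h
    calc _ = 2 ^ p * (2 ^ (-p) * (1 + ‖x‖ ^ (p / (p - 1))) ^ (-p)) := by
          rw [← mul_assoc, ← Real.rpow_add (by norm_num)]; simp
      _ ≤ _ := by gcongr
  rw [bubble_eq, Real.mul_rpow ha₀.le (by positivity), ← Real.rpow_mul hW.le, neg_mul, e, mul_assoc]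
  gcongr

/-- The norm is linear in `a₀`, so the bound 2 caps `a₀` in terms of `n` and `p` alone; this makes
the final constant uniform. -/
theorem exists_bubble_amplitude_le (n : ℕ) (p : ℝ) :
    ∃ a : ℝ, ∀ a₀ : ℝ, 0 < a₀ →
      eLpNorm (bubble n p a₀) (ENNReal.ofReal (pStar n p)) volume ≤ 2 →
      0 < pStar n p → 1 < p → a₀ ≤ a := by
  refine ⟨2 / (eLpNorm (bubble n p 1) (ENNReal.ofReal (pStar n p)) volume).toReal,
    fun a₀ ha h hr hp1 => ?_⟩
  have hb : bubble n p a₀ = a₀ • bubble n p 1 := by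
    ext x; simp [bubble, div_eq_mul_inv]
  rw [hb, eLpNorm_const_smul] at h
  set N := eLpNorm (bubble n p 1) (ENNReal.ofReal (pStar n p)) volume with hN
  have h0 : N ≠ 0 := by
    rw [hN, Ne, eLpNorm_eq_zero_iff (contDiff_bubble hp1).continuous.aestronglyMeasurable (by simpa)]
    intro h
    obtain ⟨x, hx⟩ := h.exists
    exact (bubble_pos (n := n) (p := p) one_pos x).ne' hx
  -- An infinite norm would contradict the bound 2, so integrability of the profile need not be
  -- computed.
  have htop : N ≠ ⊤ := by
    rintro h'
    rw [h', ENNReal.mul_top (by simpa using ha.ne')] at h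
    simp at h
  rw [le_div_iff₀ (ENNReal.toReal_pos h0 htop)]
  have := ENNReal.toReal_mono (by simp) h
  simpa [ENNReal.toReal_mul, abs_of_pos ha] using this

/-! ### Passage to the closure -/

theorem norm_gradient {n : ℕ} (f : Eucl n → ℝ) (x : Eucl n) : ‖gradient f x‖ = ‖fderiv ℝ f x‖ := by
  simp [gradient]

theorem lintegral_add_rpow_le_of_memHomSobolev {n : ℕ} {p r ε : ℝ} {C : ENNReal}
    {v φ : Eucl n → ℝ} {G : Eucl n → Eucl n} (hp1 : 1 < p) (hp2 : p < 2) (hC : C ≠ ⊤)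
    (hv : Continuous v) (hv0 : ∀ x, 0 < v x) (hε : 0 < ε)
    (hsmooth : ∀ ψ : Eucl n → ℝ, ContDiff ℝ 1 ψ → HasCompactSupport ψ → ∀ J : ENNReal,
      ∫⁻ x, ENNReal.ofReal ((‖fderiv ℝ v x‖ + ‖fderiv ℝ ψ x‖) ^ (p - 2) * ‖fderiv ℝ ψ x‖ ^ 2) ≤ J →
      ∫⁻ x, ENNReal.ofReal ((v x + |ψ x|) ^ (r - 2) * |ψ x| ^ 2) ≤ C * (J + J ^ (r / p)))
    (hφ : MemHomSobolev p φ G) {E : ENNReal}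
    (hE : ∫⁻ x, ENNReal.ofReal ((‖fderiv ℝ v x‖ + ε * ‖G x‖) ^ (p - 2) * (ε * ‖G x‖) ^ 2) = E) :
    ∫⁻ x, ENNReal.ofReal ((v x + ε * |φ x|) ^ (r - 2) * (ε * |φ x|) ^ 2) ≤
      C * (4 * E + (4 * E) ^ (r / p)) := by
  obtain ⟨⟨hφl, hGl, -⟩, ψ, hψ, hgrad, hloc⟩ := hφ
  simp only [ENNReal.ofReal_one, mul_one] at hgrad
  have hψ1 (k : ℕ) : ContDiff ℝ 1 (ψ k) := (hψ k).1.of_le (by exact_mod_cast le_top)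
  let d : ℕ → ENNReal := fun k => ∫⁻ x, ‖gradient (ψ k) x - G x‖ₑ ^ p
  -- The energy of `εψ_k` is at most `J k` by `add_rpow_mul_sq_le_add`, and `J k` tends to `4E`.
  let J : ℕ → ENNReal := fun k => 4 * E + 4 * ENNReal.ofReal (ε ^ p) * d k
  have hJ : Tendsto J atTop (𝓝 (4 * E)) := by
    have : Tendsto (fun k => 4 * ENNReal.ofReal (ε ^ p) * d k) atTop (𝓝 0) := by
      simpa using ENNReal.Tendsto.const_mul hgrad (Or.inr (by finiteness))
    simpa using tendsto_const_nhds.add this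
  have hlim : Tendsto (fun k => C * (J k + J k ^ (r / p))) atTop
      (𝓝 (C * (4 * E + (4 * E) ^ (r / p)))) :=
    ENNReal.Tendsto.const_mul (hJ.add (hJ.ennrpow_const _)) (Or.inr hC)
  have hk (k : ℕ) : ∫⁻ x, ENNReal.ofReal ((v x + ε * |ψ k x|) ^ (r - 2) * (ε * |ψ k x|) ^ 2) ≤
      C * (J k + J k ^ (r / p)) := by
    have hfd (x : Eucl n) : ‖fderiv ℝ (fun y => ε * ψ k y) x‖ = ε * ‖gradient (ψ k) x‖ := by
      rw [fderiv_const_mul ((hψ1 k).differentiable one_ne_zero x), norm_smul, norm_gradient,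
        Real.norm_of_nonneg hε.le]
    have h := hsmooth (fun x => ε * ψ k x) (contDiff_const.mul (hψ1 k)) (hψ k).2.mul_left (J k) ?_
    · simpa only [abs_mul, abs_of_pos hε] using h
    have hmeas : AEMeasurable (fun x => ‖gradient (ψ k) x - G x‖ₑ ^ p) := by
      have h1 : Continuous (gradient (ψ k)) :=
        (InnerProductSpace.toDual ℝ (Eucl n)).symm.continuous.comp
          ((hψ1 k).continuous_fderiv one_ne_zero)
      exact (h1.aestronglyMeasurable.sub hGl.aestronglyMeasurable).enorm.pow_const p
    calc _ ≤ ∫⁻ x, (4 * ENNReal.ofReal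
            ((‖fderiv ℝ v x‖ + ε * ‖G x‖) ^ (p - 2) * (ε * ‖G x‖) ^ 2) +
          4 * ENNReal.ofReal (ε ^ p) * ‖gradient (ψ k) x - G x‖ₑ ^ p) := by
          refine lintegral_mono fun x => ?_
          have htri : ε * ‖gradient (ψ k) x‖ ≤ ε * ‖G x‖ + ε * ‖gradient (ψ k) x - G x‖ := by
            rw [← mul_add]
            gcongr
            have := norm_add_le (G x) (gradient (ψ k) x - G x)
            rwa [add_sub_cancel] at this
          rw [hfd]
          refine (ENNReal.ofReal_le_ofReal (add_rpow_mul_sq_le_add hp1 hp2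
            (norm_nonneg (fderiv ℝ v x)) (by positivity) (by positivity) (by positivity)
            htri)).trans_eq ?_
          rw [ENNReal.ofReal_add (by positivity) (by positivity),
            ENNReal.ofReal_mul (by norm_num : (0 : ℝ) ≤ 4),
            ENNReal.ofReal_mul (by norm_num : (0 : ℝ) ≤ 4),
            Real.mul_rpow hε.le (norm_nonneg _), ENNReal.ofReal_mul (by positivity : 0 ≤ ε ^ p),
            ← ENNReal.ofReal_rpow_of_nonneg (norm_nonneg _) (by linarith), ofReal_norm,
            show ENNReal.ofReal 4 = 4 by simp, mul_assoc]
      _ = J k := by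
          rw [lintegral_add_right' _ (hmeas.const_mul _),
            lintegral_const_mul' _ _ ENNReal.ofNat_ne_top, lintegral_const_mul' _ _ (by finiteness),
            hE]
  have hcont (x : Eucl n) :
      Continuous fun s : ℝ => ENNReal.ofReal ((v x + ε * |s|) ^ (r - 2) * (ε * |s|) ^ 2) := by
    refine ENNReal.continuous_ofReal.comp (Continuous.mul (Continuous.rpow_const (by fun_prop)
      fun s => Or.inl ?_) (by fun_prop))
    have := hv0 x
    positivity
  -- Convergence in `L¹` on a ball gives an a.e. convergent subsequence there; Fatou applies on each
  -- ball with the same bound, and the balls exhaust the space.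
  have hball (j : ℕ) : ∫⁻ x in Metric.closedBall (0 : Eucl n) j,
      ENNReal.ofReal ((v x + ε * |φ x|) ^ (r - 2) * (ε * |φ x|) ^ 2) ≤
        C * (4 * E + (4 * E) ^ (r / p)) := by
    have hKc := isCompact_closedBall (0 : Eucl n) (j : ℝ)
    have hm : TendstoInMeasure (volume.restrict (Metric.closedBall (0 : Eucl n) j)) ψ atTop φ := by
      refine tendstoInMeasure_of_tendsto_eLpNorm one_ne_zero
        (fun k => (hψ1 k).continuous.aestronglyMeasurable) hφl.aestronglyMeasurable.restrict ?_
      simpa only [eLpNorm_one_eq_lintegral_enorm, Pi.sub_apply] using hloc _ hKc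
    obtain ⟨ns, hns, hae⟩ := hm.exists_seq_tendsto_ae
    calc _ = ∫⁻ x in Metric.closedBall (0 : Eucl n) j, liminf (fun i => ENNReal.ofReal
          ((v x + ε * |ψ (ns i) x|) ^ (r - 2) * (ε * |ψ (ns i) x|) ^ 2)) atTop := by
          refine lintegral_congr_ae ?_
          filter_upwards [hae] with x hx
          exact (((hcont x).tendsto (φ x)).comp hx).liminf_eq.symm
      _ ≤ liminf (fun i => ∫⁻ x in Metric.closedBall (0 : Eucl n) j, ENNReal.ofReal
          ((v x + ε * |ψ (ns i) x|) ^ (r - 2) * (ε * |ψ (ns i) x|) ^ 2)) atTop := by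
          refine lintegral_liminf_le fun i => ?_
          have h1 := (hψ1 (ns i)).continuous.measurable
          have h2 := hv.measurable
          have h3 : Measurable fun x => ε * |ψ (ns i) x| := by
            simp only [← Real.norm_eq_abs]; exact h1.norm.const_mul ε
          exact (((h2.add h3).pow_const _).mul (h3.pow_const 2)).ennreal_ofReal
      _ ≤ liminf (fun i => C * (J (ns i) + J (ns i) ^ (r / p))) atTop :=
          liminf_le_liminf (Eventually.of_forall fun i => (setLIntegral_le_lintegral _ _).trans
            (hk (ns i)))
      _ = _ := (hlim.comp hns.tendsto_atTop).liminf_eq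
  have hmf : AEMeasurable
      fun x => ENNReal.ofReal ((v x + ε * |φ x|) ^ (r - 2) * (ε * |φ x|) ^ 2) := by
    have h1 : AEMeasurable φ := hφl.aestronglyMeasurable.aemeasurable
    have h3 : AEMeasurable fun x => ε * |φ x| := by
      simp only [← Real.norm_eq_abs]; exact h1.norm.const_mul ε
    exact (((hv.measurable.aemeasurable.add h3).pow_const _).mul (h3.pow_const 2)).ennreal_ofReal
  have hcov : AECover (volume : Measure (Eucl n)) atTop
      fun j : ℕ => Metric.closedBall (0 : Eucl n) j :=
    aecover_closedBall tendsto_natCast_atTop_atTop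
  exact le_of_tendsto' (hcov.lintegral_tendsto_of_nat hmf) hball

end SobolevStability

theorem corollary3p4 (n : ℕ) (p : ℝ) (hp : 1 < p) (hpn : p ≤ 2 * (n : ℝ) / ((n : ℝ) + 2)) :
    ∃ ε₀ : ℝ, 0 < ε₀ ∧ ∃ C : ℝ, 0 < C ∧
      ∀ a₀ : ℝ, 0 < a₀ →
      1 / 2 ≤ eLpNorm (SobolevStability.bubble n p a₀)
        (ENNReal.ofReal (SobolevStability.pStar n p)) volume →
      eLpNorm (SobolevStability.bubble n p a₀)
        (ENNReal.ofReal (SobolevStability.pStar n p)) volume ≤ 2 →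
      ∀ ε : ℝ, 0 < ε → ε < ε₀ →
      ∀ (φ : SobolevStability.Eucl n → ℝ)
        (Dφ : SobolevStability.Eucl n → SobolevStability.Eucl n),
      SobolevStability.MemHomSobolev p φ Dφ →
      SobolevStability.MemWeightedHomSobolev 2
        (fun x => ‖gradient (SobolevStability.bubble n p a₀) x‖ ^ (p - 2)) φ Dφ →
      SobolevStability.orliczEnergy p ε (SobolevStability.bubble n p a₀) Dφ ≤ 1 →
      ∫⁻ x, ENNReal.ofReal
          ((SobolevStability.bubble n p a₀ x + ε * |φ x|) ^ (SobolevStability.pStar n p - 2)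
            * |φ x| ^ 2)
        ≤ ENNReal.ofReal C *
          SobolevStability.orliczEnergy p ε (SobolevStability.bubble n p a₀) Dφ := by
  open SobolevStability in
  have hmul : p * (n + 2) ≤ 2 * n := by rwa [le_div_iff₀ (by positivity)] at hpn
  have hn : 3 ≤ n := by
    have : (2 : ℝ) < n := by nlinarith [(Nat.cast_nonneg n : (0 : ℝ) ≤ n)]
    exact_mod_cast this
  have hn3 : (3 : ℝ) ≤ n := by exact_mod_cast hn
  have hp2 : p < 2 := by nlinarith
  have hpn' : p < n := by linarith
  have hnp : 0 < n - p := by linarith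
  have hp0 : 0 < p := by linarith
  have hr := pStar_pos hp0 hpn'
  have hr2 : pStar n p ≤ 2 := by
    unfold pStar; rw [div_le_iff₀ hnp]; linarith
  have hrp : 1 ≤ pStar n p / p := by
    rw [one_le_div hp0]; unfold pStar; rw [le_div_iff₀ hnp]; nlinarith
  obtain ⟨a, ha⟩ := exists_bubble_amplitude_le n p
  -- The maximum with 1 secures `K ≥ 1`.
  obtain ⟨C, hC, hmain⟩ := exists_lintegral_add_rpow_le hn hp hp2 hr2
    (le_max_left 1 (2 * ((n - p) / p * (p / (p - 1))))) (a ^ (pStar n p - p) * 2 ^ p)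
  set r := pStar n p
  have hD : C * (4 + 4 ^ (r / p)) ≠ ⊤ := ENNReal.mul_ne_top hC
    (ENNReal.add_ne_top.2 ⟨by simp, ENNReal.rpow_ne_top_of_nonneg (by linarith) (by simp)⟩)
  refine ⟨1, one_pos, (C * (4 + 4 ^ (r / p))).toReal + 1, by positivity,
    fun a₀ ha₀ _ hnorm ε hε hε1 φ G hφ _ hE => ?_⟩
  have hscale : ∫⁻ x, ENNReal.ofReal ((‖fderiv ℝ (bubble n p a₀) x‖ + ε * ‖G x‖) ^ (p - 2) *
      (ε * ‖G x‖) ^ 2) = ENNReal.ofReal (ε ^ 2) * orliczEnergy p ε (bubble n p a₀) G := by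
    rw [orliczEnergy, ← lintegral_const_mul' _ _ ENNReal.ofReal_ne_top]
    refine lintegral_congr fun x => ?_
    rw [← ENNReal.ofReal_mul (by positivity), norm_gradient]
    ring_nf
  have h := lintegral_add_rpow_le_of_memHomSobolev hp hp2 hC (contDiff_bubble hp).continuous
    (bubble_pos ha₀) hε (fun ψ => hmain (bubble n p a₀) ψ (contDiff_bubble hp) (bubble_pos ha₀)
      (fderiv_bubble_self_nonpos hp hpn'.le ha₀)
      (fun x => (norm_fderiv_bubble_le hp hpn'.le ha₀ x).trans (by
        have := bubble_pos (n := n) (p := p) ha₀ x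
        have := bracket_pos x
        gcongr
        exact le_max_right _ _))
      (bubble_rpow_le hp hpn' ha₀ (ha a₀ ha₀ hnorm hr hp))) hφ hscale
  set E := orliczEnergy p ε (bubble n p a₀) G
  have hεtop : ENNReal.ofReal (ε ^ 2) ≠ ⊤ := ENNReal.ofReal_ne_top
  have hεzero : ENNReal.ofReal (ε ^ 2) ≠ 0 := by simpa using hε.ne'
  have hEε : ENNReal.ofReal (ε ^ 2) * E ≤ 1 :=
    mul_le_one' (ENNReal.ofReal_le_one.2 (by nlinarith)) hE
  have hleft : ∫⁻ x, ENNReal.ofReal ((bubble n p a₀ x + ε * |φ x|) ^ (r - 2) * (ε * |φ x|) ^ 2) =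
      ENNReal.ofReal (ε ^ 2) *
        ∫⁻ x, ENNReal.ofReal ((bubble n p a₀ x + ε * |φ x|) ^ (r - 2) * |φ x| ^ 2) := by
    rw [← lintegral_const_mul' _ _ hεtop]
    refine lintegral_congr fun x => ?_
    rw [← ENNReal.ofReal_mul (by positivity)]
    ring_nf
  rw [hleft] at h
  -- Both sides are multiplied by `ε²` to return to `ψ = εφ`, where `ε²E ≤ 1` lets the power `p*/p`
  -- be dropped.
  rw [← ENNReal.mul_le_mul_iff_right hεzero hεtop]
  calc _ ≤ _ := h
    _ ≤ C * (4 * (ENNReal.ofReal (ε ^ 2) * E) +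
          4 ^ (r / p) * (ENNReal.ofReal (ε ^ 2) * E)) := by
        rw [ENNReal.mul_rpow_of_nonneg _ _ (by linarith : 0 ≤ r / p)]
        gcongr
        exact ENNReal.rpow_le_self_of_le_one hEε hrp
    _ = ENNReal.ofReal (ε ^ 2) * (C * (4 + 4 ^ (r / p)) * E) := by ring
    _ ≤ _ := by
        gcongr
        rw [← ENNReal.ofReal_toReal hD]
        exact ENNReal.ofReal_le_ofReal (by simp)
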